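/- **Setting.** Let $N=N_1+\dots+N_n$ and let $A=[A_1,\dots,A_n]\in\mathbb{R}^{m\times N}$ have nonzero column blocks $A_i\in\mathbb{R}^{m\times N_i}$. For $x\in\mathbb{R}^N$ let $x^{(i)}\in\mathbb{R}^{N_i}$ be its $i$-th block, and for $S\subseteq[n]=\{1,\dots,n\}$ let $h_{[S]}$ be the vector obtained from $h\in\mathbb{R}^N$ by zeroing out the blocks outside $S$. Let $A_{ji}$ be the $j$-th row of $A_i$. Let $B_i\in\mathbb{R}^{N_i\times N_i}$ be symmetric positive definite, $v_1,\dots,v_m>0$, and for $p\in\{1,2\}$ put $$\|z\|_v=\Big(\sum_{j=1}^m v_j^p|z_j|^p\Big)^{1/p},\qquad \|z\|_v^*=\max_{\|z'\|_v\le 1}\langle z',z\rangle ,\qquad z\in\mathbb{R}^m .$$ Let $f(x)=\max_{z\in Q}\{\langle Ax,z\rangle-g(z)\}$, where $Q\subseteq\mathbb{R}^m$ is nonempty, compact and convex and $g:\mathbb{R}^m\to\mathbb{R}$ is convex, and suppose that $f$ is *Nesterov separable of degree* $\omega\in\mathbb{N}$, i.e. $\max_{1\le j\le m}|\{i : A_{ji}\ne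 0\}|\le\omega$. Let $d:\mathbb{R}^m\to\mathbb{R}$ be $\sigma$-strongly convex on $Q$ with respect to $\|\cdot\|_v$ ($\sigma>0$), nonnegative on $Q$, with $d(z_0)=0$ for some $z_0\in Q$, and for $\mu>0$ let $$f_\mu(x)=\sup_{z\in Q}\{\langle Ax,z\rangle-g(z)-\mu d(z)\}$$ (a maximum if $d$ is continuous on $Q$). Define weights $w^*=(w_1^*,\dots,w_n^*)$ by $$w_i^*=\max\{(\|A_iB_i^{-1/2}t\|_v^*)^2 : t\in\mathbb{R}^{N_i},\ \textstyle\sum_k t_k^2=1\}.$$ Let $\hat S$ be a $\tau$-nice sampling with $\tau\ge1$: a random subset of $[n]$ with $|\hat S|=\tau$ almost surely, all subsets of cardinality $\tau$ being equally likely. A differentiable function $\phi:\mathbb{R}^N\to\mathbb{R}$ *admits a $(\beta,w)$-ESO with respect to* $\hat S$, where $\beta>0$ and $w\in\mathbb{R}^n$ has positive entries, if for all $x,h\in\mathbb{R}^N$ $$\mathbf{E}\big[\phi(x+h_{[\hat S]})\big]\le\phi(x)+\frac{\mathbf{E}[|\hat S|]}{n}\Big(\langle\nabla\phi(x),h\rangle+\frac{\beta}{2}\sum_{i=1}^n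 w_i\langle B_ih^{(i)},h^{(i)}\rangle\Big).$$ **Theorem.** In this setting $f_\mu$ is differentiable, $w_i^*>0$ for all $i$, and $f_\mu$ admits a $\big(\tfrac{\beta'}{\mu\sigma},w^*\big)$-ESO with respect to $\hat S$, where $\beta'>0$ is given as follows. * If $p=2$: $$\beta'=1+\frac{(\omega-1)(\tau-1)}{\max(1,n-1)}.$$ * If $p=1$ and $\omega\le n$: $$\beta'=\sum_{k=1}^{k_{\max}}\min\Big\{1,\ \frac{mn}{\tau}\sum_{l=\max\{k,k_{\min}\}}^{k_{\max}}c_l\,\pi_l\Big\},$$ where $k_{\min}=\max\{1,\tau-(n-\omega)\}$, $k_{\max}=\min\{\tau,\omega\}$, $\pi_l=\binom{\omega}{l}\binom{n-\omega}{\tau-l}\big/\binom{n}{\tau}$, and $c_l=\max\{\tfrac{l}{\omega},\tfrac{\tau-l}{n-\omega}\}$ if $\omega<n$, $c_l=\tfrac{l}{\omega}$ if $\omega=n$. -/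

import Mathlib

open MeasureTheory Matrix
open scoped MatrixOrder

noncomputable section

namespace NesterovESO

/-- `ℝ^N` with `N = N₁ + ⋯ + Nₙ`: coordinates are indexed by pairs
(block `i`, position inside block `i`), and the norm is the Euclidean one. -/
abbrev BlockSpace {n : ℕ} (N : Fin n → ℕ) : Type :=
  EuclideanSpace ℝ (Σ i : Fin n, Fin (N i))

variable {m n : ℕ} {N : Fin n → ℕ}

/-- The `i`-th block `x^(i) ∈ ℝ^{N_i}` of `x ∈ ℝ^N`. -/
def block (x : BlockSpace N) (i : Fin n) : Fin (N i) → ℝ := fun k => x ⟨i, k⟩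

/-- The vector `h_[S]`: blocks of `h` outside `S` are zeroed out. -/
def restrictBlocks (h : BlockSpace N) (S : Finset (Fin n)) : BlockSpace N :=
  WithLp.toLp 2 fun c => if c.1 ∈ S then h c else 0

/-- The column submatrix `A_i ∈ ℝ^{m × N_i}` of `A`. -/
def colBlock (A : Matrix (Fin m) (Σ i : Fin n, Fin (N i)) ℝ) (i : Fin n) :
    Matrix (Fin m) (Fin (N i)) ℝ :=
  A.submatrix id fun k => ⟨i, k⟩

/-- `Ω(Aᵀ e_j)`: the set of blocks `i` in which the `j`-th row of `A` does not vanish. -/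
def rowBlocks (A : Matrix (Fin m) (Σ i : Fin n, Fin (N i)) ℝ) (j : Fin m) : Set (Fin n) :=
  {i | colBlock A i j ≠ 0}

/-- The weighted `p`-norm `‖z‖_v = (∑ v_j^p |z_j|^p)^{1/p}`. -/
def vNorm (p : ℝ) (v : Fin m → ℝ) (z : Fin m → ℝ) : ℝ :=
  (∑ j, v j ^ p * |z j| ^ p) ^ (1 / p)

/-- The conjugate norm `‖z‖_v^* = max {⟨z', z⟩ : ‖z'‖_v ≤ 1}`. -/
def vDualNorm (p : ℝ) (v : Fin m → ℝ) (z : Fin m → ℝ) : ℝ :=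
  sSup ((fun z' : Fin m → ℝ => z' ⬝ᵥ z) '' {z' | vNorm p v z' ≤ 1})

/-- `d` is `σ`-strongly convex on the (convex) set `Q` with respect to `‖·‖_v`. -/
def StronglyConvexOn (p : ℝ) (v : Fin m → ℝ) (Q : Set (Fin m → ℝ)) (σ : ℝ)
    (d : (Fin m → ℝ) → ℝ) : Prop :=
  ∀ z₁ ∈ Q, ∀ z₂ ∈ Q, ∀ t : ℝ, 0 ≤ t → t ≤ 1 →
    d (t • z₁ + (1 - t) • z₂) ≤
      t * d z₁ + (1 - t) * d z₂ - σ / 2 * t * (1 - t) * vNorm p v (z₁ - z₂) ^ 2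

/-- `d` is a prox function on `Q` with parameter `σ`: it is `σ`-strongly convex on `Q`
with respect to `‖·‖_v`, nonnegative on `Q`, and vanishes at some point of `Q`. -/
def IsProxFunction (p : ℝ) (v : Fin m → ℝ) (Q : Set (Fin m → ℝ)) (σ : ℝ)
    (d : (Fin m → ℝ) → ℝ) : Prop :=
  StronglyConvexOn p v Q σ d ∧ (∀ z ∈ Q, 0 ≤ d z) ∧ ∃ z₀ ∈ Q, d z₀ = 0

/-- `f` has the form `f(x) = max_{z ∈ Q} {⟨Ax, z⟩ - g(z)}` with `Q` nonempty, compact and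
convex and `g` convex, and every row of `A` has at most `ω` nonzero blocks:
`f` is Nesterov (block) separable of degree `ω`, with representation `(A, Q, g)`. -/
def IsNesterovSeparable (A : Matrix (Fin m) (Σ i : Fin n, Fin (N i)) ℝ)
    (Q : Set (Fin m → ℝ)) (g : (Fin m → ℝ) → ℝ) (ω : ℕ) (f : BlockSpace N → ℝ) : Prop :=
  Q.Nonempty ∧ IsCompact Q ∧ Convex ℝ Q ∧ ConvexOn ℝ Set.univ g ∧
  (∀ x, f x = sSup ((fun z : Fin m → ℝ => (A *ᵥ x.ofLp) ⬝ᵥ z - g z) '' Q)) ∧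
  ∀ j, (rowBlocks A j).ncard ≤ ω

/-- `f_μ(x) = max_{z ∈ Q} {⟨Ax, z⟩ - g(z) - μ d(z)}`. -/
def smoothed (A : Matrix (Fin m) (Σ i : Fin n, Fin (N i)) ℝ)
    (Q : Set (Fin m → ℝ)) (g d : (Fin m → ℝ) → ℝ) (μ : ℝ) (x : BlockSpace N) : ℝ :=
  sSup ((fun z : Fin m → ℝ => (A *ᵥ x.ofLp) ⬝ᵥ z - g z - μ * d z) '' Q)

/-- The weights `w_i^* = max {(‖A_i B_i^{-1/2} t‖_v^*)² : t ∈ ℝ^{N_i}, ‖t‖ = 1}`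
(Euclidean norm of `t`). -/
def wStar (p : ℝ) (v : Fin m → ℝ) (A : Matrix (Fin m) (Σ i : Fin n, Fin (N i)) ℝ)
    (B : (i : Fin n) → Matrix (Fin (N i)) (Fin (N i)) ℝ) (i : Fin n) : ℝ :=
  sSup ((fun t : EuclideanSpace ℝ (Fin (N i)) =>
      vDualNorm p v (colBlock A i *ᵥ ((CFC.sqrt (B i))⁻¹ *ᵥ t.ofLp)) ^ 2) '' {t | ‖t‖ = 1})

section Sampling

variable {Om : Type*} [MeasurableSpace Om]

/-- A (block) sampling: a random subset of `[n]`. -/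
def IsSampling (S : Om → Finset (Fin n)) : Prop :=
  ∀ T : Finset (Fin n), MeasurableSet (S ⁻¹' {T})

/-- A uniform sampling: all blocks are chosen with the same probability. -/
def IsUniformSampling (P : Measure Om) (S : Om → Finset (Fin n)) : Prop :=
  IsSampling S ∧ ∀ i j : Fin n, P {s | i ∈ S s} = P {s | j ∈ S s}

/-- A `τ`-uniform sampling. -/
def IsTauUniform (P : Measure Om) (τ : ℕ) (S : Om → Finset (Fin n)) : Prop :=
  IsUniformSampling P S ∧ P {s | (S s).card = τ} = 1

/-- A `τ`-nice sampling: `τ`-uniform, and all subsets of `[n]` of cardinality `τ` are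
equally likely. -/
def IsTauNice (P : Measure Om) (τ : ℕ) (S : Om → Finset (Fin n)) : Prop :=
  IsTauUniform P τ S ∧ ∀ T₁ T₂ : Finset (Fin n), T₁.card = τ → T₂.card = τ →
    P {s | S s = T₁} = P {s | S s = T₂}

/-- `(φ, Ŝ) ∼ ESO(β, w)`: the function `φ` is differentiable, `β > 0`, `w > 0` and
`E[φ(x + h_[Ŝ])] ≤ φ(x) + E|Ŝ|/n * (⟨∇φ(x), h⟩ + β/2 * ∑ w_i ⟨B_i h^(i), h^(i)⟩)`
for all `x, h`. -/
def AdmitsESO (P : Measure Om) (S : Om → Finset (Fin n))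
    (B : (i : Fin n) → Matrix (Fin (N i)) (Fin (N i)) ℝ)
    (φ : BlockSpace N → ℝ) (β : ℝ) (w : Fin n → ℝ) : Prop :=
  Differentiable ℝ φ ∧ 0 < β ∧ (∀ i, 0 < w i) ∧
  ∀ x h : BlockSpace N,
    ∫ s, φ (x + restrictBlocks h (S s)) ∂P ≤
      φ x + (∫ s, ((S s).card : ℝ) ∂P) / n *
        (inner ℝ (gradient φ x) h + β / 2 * ∑ i, w i * ((B i *ᵥ block h i) ⬝ᵥ block h i))

end Sampling

/-- `β'₂ = 1 + (ω - 1)(τ - 1) / max(1, n - 1)`. -/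
def betaTwo (n ω τ : ℕ) : ℝ :=
  1 + ((ω : ℝ) - 1) * ((τ : ℝ) - 1) / max 1 ((n : ℝ) - 1)

/-- `k_min = max {1, τ - (n - ω)}` (for `ω ≤ n`; truncation at `0` is harmless here). -/
def kMin (n ω τ : ℕ) : ℕ := max 1 (τ - (n - ω))

/-- `k_max = min {τ, ω}`. -/
def kMax (ω τ : ℕ) : ℕ := min τ ω

/-- `c_l = max {l / ω, (τ - l) / (n - ω)}` if `ω < n`, and `c_l = l / ω` otherwise. -/
def cCoef (n ω τ l : ℕ) : ℝ :=
  if ω < n then max ((l : ℝ) / ω) (((τ : ℝ) - l) / ((n : ℝ) - ω)) else (l : ℝ) / ω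

/-- The hypergeometric probability `π_l = C(ω, l) C(n - ω, τ - l) / C(n, τ)`; it is used
only for `ω ≤ n` and `l ≤ τ ≤ n`. -/
def piProb (n ω τ l : ℕ) : ℝ :=
  (ω.choose l : ℝ) * ((n - ω).choose (τ - l) : ℝ) / (n.choose τ : ℝ)

/-- `β'₃ = ∑_{k=1}^{k_max} min {1, (m n / τ) ∑_{l = max(k, k_min)}^{k_max} c_l π_l}`. -/
def betaThree (m n ω τ : ℕ) : ℝ :=
  ∑ k ∈ Finset.Icc 1 (kMax ω τ),
    min 1 (((m : ℝ) * n / τ) *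
      ∑ l ∈ Finset.Icc (max k (kMin n ω τ)) (kMax ω τ), cCoef n ω τ l * piProb n ω τ l)

end NesterovESO

end

/-!
The smoothing `f_μ` is the composition of `A` with the conjugate of `g + μ d` on `Q`. Strong
convexity of `d` makes it differentiable, with
`f_μ (x + h) ≤ f_μ x + ⟨∇f_μ x, h⟩ + (‖A h‖_v^*)² / (2 μ σ)`. As `d` is not assumed continuous, the
maximizer that usually gives the gradient is replaced by the limit of a maximizing sequence. The
dual norm is `‖L ·‖` for the entrywise division `L` by the weights, with values in `ℓ²` if `p = 2`
and in `ℓ^∞` if `p = 1`, and `w_i^*` is by construction the best constant in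
`‖L (A_i y)‖² ≤ w_i^* ⟨B_i y, y⟩`.

Averaging over the sampling, the ESO reduces to a second moment bound for `∑_{i ∈ Ŝ} u_i`, where
`u_i = L (A_i h^(i))` and each coordinate `j` is nonzero for at most `ω` of the vectors `u_i`. For
`p = 2` the bound is computed coordinatewise from the pair probabilities of `Ŝ`. For `p = 1`,
Cauchy-Schwarz on `Ŝ ∩ R_j`, with `R_j` the support of coordinate `j` enlarged to `ω` elements,
gives the bound `#(Ŝ ∩ R_j) ∑_{i ∈ Ŝ ∩ R_j} ‖u_i‖²`. This is a sum over `k` of the mass collected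
when `#(Ŝ ∩ R_j) ≥ k`. For each `k`, the expected maximum over `j` is at most the trivial bound
`τ / n ∑_i ‖u_i‖²`, and also at most the sum over the `m` coordinates of the tails of the
hypergeometric law of `#(Ŝ ∩ R_j)`: the minimum of the two is the `k`-th summand of `β'`.
-/

namespace NesterovESO

open Filter Topology
open scoped ENNReal BigOperators

section Conjugate

variable {V : Type*} [AddCommGroup V] [Module ℝ V] [TopologicalSpace V]

/-- The convex conjugate `ℓ ↦ sup_{z ∈ Q} (ℓ z - G z)` of `G` restricted to `Q`. It is meaningful
only where the supremum is finite; this is ensured by `bddAbove_image_sub`. -/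
noncomputable def conjugateOn (Q : Set V) (G : V → ℝ) (ℓ : V →L[ℝ] ℝ) : ℝ :=
  sSup ((fun z => ℓ z - G z) '' Q)

/-- `z₀` is the limit of a maximizing sequence for `ℓ - G` on `Q`. Since `G` is not assumed to be
lower semicontinuous, a maximizer need not exist; such a limit takes over its role as a gradient of
the conjugate. -/
def IsMaximizingLimit (Q : Set V) (G : V → ℝ) (ℓ : V →L[ℝ] ℝ) (z₀ : V) : Prop :=
  ∃ y : ℕ → V, (∀ k, y k ∈ Q) ∧ Tendsto y atTop (𝓝 z₀) ∧
    Tendsto (fun k => ℓ (y k) - G (y k)) atTop (𝓝 (conjugateOn Q G ℓ))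

/-- `G` is strongly convex on `Q` with modulus `c`, distances being measured by an arbitrary
function `ν` of the difference; `StronglyConvexOn` is the case `ν = ‖·‖_v`. -/
def StronglyConvexWrt (ν : V → ℝ) (Q : Set V) (c : ℝ) (G : V → ℝ) : Prop :=
  ∀ z₁ ∈ Q, ∀ z₂ ∈ Q, ∀ t : ℝ, 0 ≤ t → t ≤ 1 →
    G (t • z₁ + (1 - t) • z₂) ≤
      t * G z₁ + (1 - t) * G z₂ - c / 2 * t * (1 - t) * ν (z₁ - z₂) ^ 2

variable {Q : Set V} {G : V → ℝ} {ℓ : V →L[ℝ] ℝ} {z₀ : V}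

lemma bddAbove_image_sub (hQ : IsCompact Q) (hG : BddBelow (G '' Q)) (ℓ : V →L[ℝ] ℝ) :
    BddAbove ((fun z => ℓ z - G z) '' Q) := by
  obtain ⟨M, hM⟩ := (hQ.image ℓ.continuous).bddAbove
  obtain ⟨b, hb⟩ := hG
  refine ⟨M - b, ?_⟩
  rintro _ ⟨z, hz, rfl⟩
  exact sub_le_sub (hM ⟨z, hz, rfl⟩) (hb ⟨z, hz, rfl⟩)

lemma le_conjugateOn (hQ : IsCompact Q) (hG : BddBelow (G '' Q)) (ℓ : V →L[ℝ] ℝ) {z : V}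
    (hz : z ∈ Q) : ℓ z - G z ≤ conjugateOn Q G ℓ :=
  le_csSup (bddAbove_image_sub hQ hG ℓ) ⟨z, hz, rfl⟩

lemma exists_isMaximizingLimit [FirstCountableTopology V] (hne : Q.Nonempty) (hQ : IsCompact Q)
    (hG : BddBelow (G '' Q)) (ℓ : V →L[ℝ] ℝ) : ∃ z₀, IsMaximizingLimit Q G ℓ z₀ := by
  obtain ⟨s, -, hs, hsQ⟩ := exists_seq_tendsto_sSup (hne.image _) (bddAbove_image_sub hQ hG ℓ)
  choose y hyQ hys using hsQ
  obtain ⟨z₀, -, ψ, hψ, hlim⟩ := hQ.tendsto_subseq hyQ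
  refine ⟨z₀, y ∘ ψ, fun k => hyQ _, hlim, ?_⟩
  exact (hs.comp hψ.tendsto_atTop).congr fun k => (hys (ψ k)).symm

lemma IsMaximizingLimit.add_le_conjugateOn (hQ : IsCompact Q) (hG : BddBelow (G '' Q))
    (hz₀ : IsMaximizingLimit Q G ℓ z₀) (η : V →L[ℝ] ℝ) :
    conjugateOn Q G ℓ + η z₀ ≤ conjugateOn Q G (ℓ + η) := by
  obtain ⟨y, hyQ, hy, hval⟩ := hz₀
  refine le_of_tendsto (hval.add ((η.continuous.tendsto z₀).comp hy)) (.of_forall fun k => ?_)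
  calc ℓ (y k) - G (y k) + η (y k) = (ℓ + η) (y k) - G (y k) := by
        rw [_root_.add_apply]; ring
    _ ≤ conjugateOn Q G (ℓ + η) := le_conjugateOn hQ hG _ (hyQ k)

variable {ν : V → ℝ} {c r : ℝ} {η : V →L[ℝ] ℝ}

/-- The quadratic gain of strong convexity enters only through its affine minorants
`η w - r² / (2c) ≤ (c / 2) ν(w)²`, so `ν` itself need not be continuous. -/
lemma combination_le_conjugateOn (hQ : IsCompact Q) (hconv : Convex ℝ Q) (hG : BddBelow (G '' Q))
    (hc : 0 < c) (hsc : StronglyConvexWrt ν Q c G) (hη : ∀ z, η z ≤ ν z * r) {y z : V}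
    (hz : z ∈ Q) (hy : y ∈ Q) {t : ℝ} (ht₀ : 0 ≤ t) (ht₁ : t ≤ 1) :
    t * (ℓ z - G z) + (1 - t) * (ℓ y - G y) + t * (1 - t) * (η (z - y) - r ^ 2 / (2 * c)) ≤
      conjugateOn Q G ℓ := by
  have hminorant : η (z - y) - r ^ 2 / (2 * c) ≤ c / 2 * ν (z - y) ^ 2 := by
    have hsq : c / 2 * ν (z - y) ^ 2 - ν (z - y) * r + r ^ 2 / (2 * c) =
        (c * ν (z - y) - r) ^ 2 / (2 * c) := by
      field_simp
      ring
    have : 0 ≤ (c * ν (z - y) - r) ^ 2 / (2 * c) := by positivity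
    linarith [hη (z - y)]
  have hgain := mul_le_mul_of_nonneg_left hminorant (mul_nonneg ht₀ (sub_nonneg.2 ht₁))
  have hval := le_conjugateOn hQ hG ℓ (hconv hz hy ht₀ (sub_nonneg.2 ht₁) (by ring))
  rw [map_add, map_smul, map_smul, smul_eq_mul, smul_eq_mul] at hval
  linarith [hsc z hz y hy t ht₀ ht₁]

lemma IsMaximizingLimit.conjugateOn_add_le (hne : Q.Nonempty) (hQ : IsCompact Q)
    (hconv : Convex ℝ Q) (hG : BddBelow (G '' Q)) (hc : 0 < c)
    (hsc : StronglyConvexWrt ν Q c G) (hη : ∀ z, η z ≤ ν z * r) (hz₀ : IsMaximizingLimit Q G ℓ z₀) :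
    conjugateOn Q G (ℓ + η) ≤ conjugateOn Q G ℓ + η z₀ + r ^ 2 / (2 * c) := by
  obtain ⟨y, hyQ, hy, hval⟩ := hz₀
  set F := conjugateOn Q G ℓ
  refine csSup_le (hne.image _) ?_
  rintro _ ⟨z, hz, rfl⟩
  have hsegment : ∀ t : ℝ, 0 < t → t ≤ 1 →
      ℓ z - G z + (1 - t) * (η z - η z₀ - r ^ 2 / (2 * c)) ≤ F := by
    intro t ht₀ ht₁
    have hlim : t * (ℓ z - G z) + (1 - t) * F +
        t * (1 - t) * (η z - η z₀ - r ^ 2 / (2 * c)) ≤ F := by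
      refine le_of_tendsto (((hval.const_mul (1 - t)).const_add _).add
        ((((η.continuous.tendsto z₀).comp hy).const_sub (η z)).sub_const _ |>.const_mul _))
        (.of_forall fun k => ?_)
      have := combination_le_conjugateOn (ℓ := ℓ) hQ hconv hG hc hsc hη hz (hyQ k) ht₀.le ht₁
      rwa [map_sub] at this
    refine le_of_mul_le_mul_left ?_ ht₀
    linarith
  have hlimit : ℓ z - G z + (1 - 0) * (η z - η z₀ - r ^ 2 / (2 * c)) ≤ F := by
    refine le_of_tendsto (f := fun t : ℝ => ℓ z - G z + (1 - t) * (η z - η z₀ - r ^ 2 / (2 * c)))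
      (x := 𝓝[>] 0) (tendsto_nhdsWithin_of_tendsto_nhds (Continuous.tendsto (by fun_prop) 0)) ?_
    filter_upwards [Ioc_mem_nhdsGT (zero_lt_one' ℝ)] with t ht using hsegment t ht.1 ht.2
  simp only [_root_.add_apply]
  linarith

end Conjugate

section Gradient

variable {X : Type*} [NormedAddCommGroup X] [InnerProductSpace ℝ X] [CompleteSpace X]

lemma hasGradientAt_of_quadratic_bounds {φ : X → ℝ} {x y : X} {C : ℝ}
    (hlower : ∀ h, φ x + inner ℝ y h ≤ φ (x + h))
    (hupper : ∀ h, φ (x + h) ≤ φ x + inner ℝ y h + C * ‖h‖ ^ 2) : HasGradientAt φ y x := by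
  rw [hasGradientAt_iff_isLittleO_nhds_zero]
  refine Asymptotics.IsBigO.trans_isLittleO (.of_bound C (.of_forall fun h => ?_))
    (Asymptotics.isLittleO_norm_pow_id one_lt_two)
  rw [Real.norm_of_nonneg (by linarith [hlower h]), Real.norm_of_nonneg (by positivity)]
  linarith [hupper h]

end Gradient

section Weights

variable {m : ℕ} {E : Type*} [NormedAddCommGroup E] [NormedSpace ℝ E]

/-- The linear map `L` represents the conjugate norm of `‖·‖_v` as `‖L u‖`: Hölder's inequality
holds, and it is sharp for every `u`. -/
structure IsDualNormMap (p : ℝ) (v : Fin m → ℝ) (L : (Fin m → ℝ) →ₗ[ℝ] E) : Prop where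
  dotProduct_le : ∀ z u, z ⬝ᵥ u ≤ vNorm p v z * ‖L u‖
  exists_dotProduct_eq : ∀ u, ∃ z, vNorm p v z ≤ 1 ∧ z ⬝ᵥ u = ‖L u‖

namespace IsDualNormMap

variable {p : ℝ} {v : Fin m → ℝ} {L : (Fin m → ℝ) →ₗ[ℝ] E}

lemma vDualNorm_eq (hL : IsDualNormMap p v L) (u : Fin m → ℝ) : vDualNorm p v u = ‖L u‖ := by
  refine IsGreatest.csSup_eq ⟨hL.exists_dotProduct_eq u, ?_⟩
  rintro _ ⟨z, hz, rfl⟩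
  exact (hL.dotProduct_le z u).trans (mul_le_of_le_one_left (norm_nonneg _) hz)

lemma injective (hL : IsDualNormMap p v L) : Function.Injective L := by
  refine (injective_iff_map_eq_zero L).2 fun u hu => ?_
  have hself : u ⬝ᵥ u ≤ 0 := by simpa [hu] using hL.dotProduct_le u u
  exact dotProduct_self_eq_zero.1 (hself.antisymm (Finset.sum_nonneg fun _ _ => mul_self_nonneg _))

end IsDualNormMap

/-- Entrywise division by the weights `v`, with values in `ℝ^m` carrying the `ℓ^q` norm. For `q`
conjugate to `p` it represents the conjugate norm of the weighted `p`-norm. -/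
noncomputable def divWeights (q : ℝ≥0∞) (v : Fin m → ℝ) :
    (Fin m → ℝ) →ₗ[ℝ] PiLp q fun _ : Fin m => ℝ where
  toFun u := WithLp.toLp q fun j => u j / v j
  map_add' x y := by ext j; simp [add_div]
  map_smul' c x := by ext j; simp [mul_div_assoc]

@[simp]
lemma divWeights_apply (q : ℝ≥0∞) (v u : Fin m → ℝ) (j : Fin m) :
    divWeights q v u j = u j / v j := rfl

lemma vNorm_one (v z : Fin m → ℝ) : vNorm 1 v z = ∑ j, v j * |z j| := by
  simp [vNorm]

lemma vNorm_two (v z : Fin m → ℝ) : vNorm 2 v z = √(∑ j, (v j * z j) ^ 2) := by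
  simp [vNorm, Real.sqrt_eq_rpow, mul_pow]

variable {v : Fin m → ℝ}

lemma isDualNormMap_two (hv : ∀ j, 0 < v j) : IsDualNormMap 2 v (divWeights 2 v) where
  dotProduct_le z u := by
    simp only [vNorm_two, EuclideanSpace.norm_eq, Real.norm_eq_abs, sq_abs, divWeights_apply]
    calc z ⬝ᵥ u = ∑ j, v j * z j * (u j / v j) :=
          Finset.sum_congr rfl fun j _ => by have := (hv j).ne'; field_simp
      _ ≤ _ := Real.sum_mul_le_sqrt_mul_sqrt _ _ _
  exists_dotProduct_eq u := by
    set r := ‖divWeights 2 v u‖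
    have hr : ∑ j, (u j / v j) ^ 2 = r ^ 2 :=
      (EuclideanSpace.real_norm_sq_eq (divWeights 2 v u)).symm
    rcases eq_or_ne r 0 with h0 | h0
    · exact ⟨0, by simp [vNorm_two], by simp [h0]⟩
    refine ⟨fun j => u j / v j ^ 2 / r, ?_, ?_⟩
    · have hterm : ∀ j, (v j * (u j / v j ^ 2 / r)) ^ 2 = (u j / v j) ^ 2 / r ^ 2 := fun j => by
        have := (hv j).ne'
        field_simp
      simp_rw [vNorm_two, hterm]
      rw [← Finset.sum_div, hr, div_self (pow_ne_zero 2 h0), Real.sqrt_one]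
    · have hterm : ∀ j, u j / v j ^ 2 / r * u j = (u j / v j) ^ 2 / r := fun j => by
        have := (hv j).ne'
        field_simp
      simp_rw [dotProduct, hterm]
      rw [← Finset.sum_div, hr, sq, mul_self_div_self]

lemma exists_norm_eq_norm_apply {κ : Type*} [Fintype κ] [Nonempty κ]
    (u : PiLp ∞ fun _ : κ => ℝ) : ∃ j, ‖u‖ = ‖u j‖ := by
  obtain ⟨j, hj⟩ := exists_eq_ciSup_of_finite (f := fun j => ‖u j‖)
  exact ⟨j, by rw [PiLp.norm_eq_ciSup, hj]⟩

lemma isDualNormMap_one (hv : ∀ j, 0 < v j) : IsDualNormMap 1 v (divWeights ∞ v) where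
  dotProduct_le z u := by
    rw [vNorm_one, dotProduct, Finset.sum_mul]
    refine Finset.sum_le_sum fun j _ => ?_
    have hvj := hv j
    calc z j * u j ≤ |z j * u j| := le_abs_self _
      _ = v j * |z j| * ‖divWeights ∞ v u j‖ := by
        rw [divWeights_apply, Real.norm_eq_abs, abs_div, abs_mul, abs_of_pos hvj]
        field_simp
      _ ≤ v j * |z j| * ‖divWeights ∞ v u‖ := by
        gcongr
        exact PiLp.norm_apply_le _ j
  exists_dotProduct_eq u := by
    rcases isEmpty_or_nonempty (Fin m) with hm | hm
    · exact ⟨0, by simp [vNorm_one], by simp [Subsingleton.elim u 0]⟩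
    obtain ⟨j, hj⟩ := exists_norm_eq_norm_apply (divWeights ∞ v u)
    have hvj := hv j
    refine ⟨Pi.single j (SignType.sign (u j) / v j), ?_, ?_⟩
    · rw [vNorm_one, Finset.sum_eq_single_of_mem j (Finset.mem_univ j) fun i _ hi => by
        simp [Pi.single_eq_of_ne hi], Pi.single_eq_same, abs_div, abs_of_pos hvj,
        mul_div_cancel₀ _ hvj.ne']
      rcases lt_trichotomy (u j) 0 with h | h | h <;> simp [h]
    · rw [hj, single_dotProduct, divWeights_apply, Real.norm_eq_abs, abs_div, abs_of_pos hvj,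
        div_mul_eq_mul_div, sign_mul_self]

end Weights

section WeightBound

variable {E F : Type*} [NormedAddCommGroup E] [NormedSpace ℝ E] [NormedAddCommGroup F]
  [NormedSpace ℝ F]

lemma norm_apply_sq_le_sSup_unitSphere (T : E →L[ℝ] F) (x : E) :
    ‖T x‖ ^ 2 ≤ sSup ((fun t => ‖T t‖ ^ 2) '' {t | ‖t‖ = 1}) * ‖x‖ ^ 2 := by
  have hbdd : BddAbove ((fun t => ‖T t‖ ^ 2) '' {t | ‖t‖ = 1}) := by
    refine ⟨‖T‖ ^ 2, ?_⟩
    rintro _ ⟨t, ht, rfl⟩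
    exact pow_le_pow_left₀ (norm_nonneg _) (T.unit_le_opNorm t ht.le) 2
  rcases eq_or_ne x 0 with rfl | hx
  · simp
  have hunit : ‖‖x‖⁻¹ • x‖ = 1 := norm_smul_inv_norm (𝕜 := ℝ) hx
  calc ‖T x‖ ^ 2 = ‖T (‖x‖⁻¹ • x)‖ ^ 2 * ‖x‖ ^ 2 := by
        have := norm_ne_zero_iff.2 hx
        rw [map_smul, norm_smul, norm_inv, norm_norm]
        field_simp
    _ ≤ _ := by
        gcongr
        exact le_csSup hbdd ⟨_, hunit, rfl⟩

variable {κ : Type*} [Fintype κ] {M : Matrix κ κ ℝ}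

open scoped Classical in
lemma dotProduct_sqrt_mulVec_self (hM : M.PosSemidef) (y : κ → ℝ) :
    (CFC.sqrt M *ᵥ y) ⬝ᵥ (CFC.sqrt M *ᵥ y) = (M *ᵥ y) ⬝ᵥ y := by
  have hsymm : (CFC.sqrt M)ᵀ = CFC.sqrt M := by
    simpa using (CFC.sqrt_nonneg M).posSemidef.isHermitian.eq
  rw [dotProduct_mulVec, ← mulVec_transpose, hsymm, mulVec_mulVec,
    CFC.sqrt_mul_sqrt_self M hM.nonneg]

lemma inv_sqrt_mulVec_sqrt_mulVec [DecidableEq κ] (hM : M.PosDef) (y : κ → ℝ) :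
    (CFC.sqrt M)⁻¹ *ᵥ (CFC.sqrt M *ᵥ y) = y := by
  have hunit : IsUnit (CFC.sqrt M) := (CFC.isUnit_sqrt_iff M hM.posSemidef.nonneg).2 hM.isUnit
  rw [mulVec_mulVec, nonsing_inv_mul _ ((isUnit_iff_isUnit_det _).1 hunit), one_mulVec]

variable {m n : ℕ} {N : Fin n → ℕ} {p : ℝ} {v : Fin m → ℝ} {L : (Fin m → ℝ) →ₗ[ℝ] E}
  {B : (i : Fin n) → Matrix (Fin (N i)) (Fin (N i)) ℝ}

lemma IsDualNormMap.norm_colBlock_mulVec_sq_le (hL : IsDualNormMap p v L)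
    (A : Matrix (Fin m) (Σ i : Fin n, Fin (N i)) ℝ) {i : Fin n} (hB : (B i).PosDef)
    (y : Fin (N i) → ℝ) :
    ‖L (colBlock A i *ᵥ y)‖ ^ 2 ≤ wStar p v A B i * ((B i *ᵥ y) ⬝ᵥ y) := by
  let T : EuclideanSpace ℝ (Fin (N i)) →L[ℝ] E := LinearMap.toContinuousLinearMap
    (L ∘ₗ (colBlock A i).mulVecLin ∘ₗ (CFC.sqrt (B i))⁻¹.mulVecLin ∘ₗ
      (WithLp.linearEquiv 2 ℝ (Fin (N i) → ℝ)).toLinearMap)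
  have hT : ∀ t, T t = L (colBlock A i *ᵥ ((CFC.sqrt (B i))⁻¹ *ᵥ t.ofLp)) := fun _ => rfl
  have hbound := norm_apply_sq_le_sSup_unitSphere T (WithLp.toLp 2 (CFC.sqrt (B i) *ᵥ y))
  simp only [hT, inv_sqrt_mulVec_sqrt_mulVec hB, EuclideanSpace.real_norm_sq_eq] at hbound
  simp only [wStar, hL.vDualNorm_eq]
  rwa [← dotProduct_sqrt_mulVec_self hB.posSemidef, dotProduct, ← funext fun k => sq _]

lemma IsDualNormMap.wStar_pos (hL : IsDualNormMap p v L)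
    {A : Matrix (Fin m) (Σ i : Fin n, Fin (N i)) ℝ} {i : Fin n} (hA : colBlock A i ≠ 0)
    (hB : (B i).PosDef) : 0 < wStar p v A B i := by
  obtain ⟨y, hy⟩ : ∃ y, colBlock A i *ᵥ y ≠ 0 := by
    by_contra! h
    exact hA (mulVec_injective (funext fun y => by simp [h]))
  have hpos : 0 < ‖L (colBlock A i *ᵥ y)‖ ^ 2 := by
    have := (map_ne_zero_iff L hL.injective).2 hy
    positivity
  have hquad : 0 ≤ (B i *ᵥ y) ⬝ᵥ y := by
    simpa [dotProduct_comm] using hB.posSemidef.dotProduct_mulVec_nonneg y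
  exact pos_of_mul_pos_left (hpos.trans_le (hL.norm_colBlock_mulVec_sq_le A hB y)) hquad

end WeightBound

section Blocks

variable {m n : ℕ} {N : Fin n → ℕ}

lemma dotProduct_restrictBlocks (f : (Σ i : Fin n, Fin (N i)) → ℝ) (h : BlockSpace N)
    (T : Finset (Fin n)) :
    f ⬝ᵥ (restrictBlocks h T).ofLp = ∑ i ∈ T, (fun k => f ⟨i, k⟩) ⬝ᵥ block h i := by
  rw [dotProduct, Fintype.sum_sigma, ← Finset.sum_subset T.subset_univ fun i _ hi => by
    simp [restrictBlocks, hi]]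
  exact Finset.sum_congr rfl fun i hi => by simp [dotProduct, restrictBlocks, block, hi]

lemma restrictBlocks_univ (h : BlockSpace N) : restrictBlocks h Finset.univ = h := by
  simp [restrictBlocks]

lemma mulVec_restrictBlocks (A : Matrix (Fin m) (Σ i : Fin n, Fin (N i)) ℝ) (h : BlockSpace N)
    (T : Finset (Fin n)) :
    A *ᵥ (restrictBlocks h T).ofLp = ∑ i ∈ T, colBlock A i *ᵥ block h i := by
  ext j
  rw [Finset.sum_apply]
  exact dotProduct_restrictBlocks (A j) h T

lemma inner_restrictBlocks (y h : BlockSpace N) (T : Finset (Fin n)) :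
    inner ℝ y (restrictBlocks h T) = ∑ i ∈ T, block y i ⬝ᵥ block h i := by
  rw [EuclideanSpace.inner_eq_star_dotProduct, star_trivial, dotProduct_comm]
  exact dotProduct_restrictBlocks y.ofLp h T

lemma inner_eq_sum_block (y h : BlockSpace N) :
    inner ℝ y h = ∑ i, block y i ⬝ᵥ block h i := by
  rw [← inner_restrictBlocks, restrictBlocks_univ]

lemma support_colBlock_mulVec_subset (A : Matrix (Fin m) (Σ i : Fin n, Fin (N i)) ℝ) (j : Fin m)
    (y : (i : Fin n) → Fin (N i) → ℝ) :
    (Function.support fun i => (colBlock A i *ᵥ y i) j) ⊆ rowBlocks A j := by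
  intro i hi hzero
  exact hi (by simp [mulVec, hzero])

end Blocks

section Smoothing

variable {m n : ℕ} {N : Fin n → ℕ}

/-- The linear map `x ↦ ⟨A x, ·⟩`. The smoothing `f_μ` is the composition with it of the conjugate
of `g + μ d` on `Q`. -/
noncomputable def pairing (A : Matrix (Fin m) (Σ i : Fin n, Fin (N i)) ℝ) :
    BlockSpace N →ₗ[ℝ] (Fin m → ℝ) →L[ℝ] ℝ :=
  LinearMap.toContinuousLinearMap.toLinearMap ∘ₗ dotProductBilin ℝ ℝ ∘ₗ A.mulVecLin ∘ₗ
    (WithLp.linearEquiv 2 ℝ _).toLinearMap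

lemma pairing_apply (A : Matrix (Fin m) (Σ i : Fin n, Fin (N i)) ℝ) (x : BlockSpace N)
    (z : Fin m → ℝ) : pairing A x z = (A *ᵥ x.ofLp) ⬝ᵥ z := rfl

variable {A : Matrix (Fin m) (Σ i : Fin n, Fin (N i)) ℝ} {Q : Set (Fin m → ℝ)}
  {g d : (Fin m → ℝ) → ℝ} {μ σ p : ℝ} {v : Fin m → ℝ}

lemma smoothed_eq_conjugateOn (x : BlockSpace N) :
    smoothed A Q g d μ x = conjugateOn Q (fun z => g z + μ * d z) (pairing A x) := by
  simp only [smoothed, conjugateOn, pairing_apply, sub_sub]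

lemma StronglyConvexOn.stronglyConvexWrt_add_const_mul (hd : StronglyConvexOn p v Q σ d)
    (hg : ConvexOn ℝ Q g) (hμ : 0 ≤ μ) :
    StronglyConvexWrt (vNorm p v) Q (μ * σ) fun z => g z + μ * d z := by
  intro z₁ hz₁ z₂ hz₂ t ht₀ ht₁
  have hconvex := hg.2 hz₁ hz₂ ht₀ (sub_nonneg.2 ht₁) (by ring)
  have hstrong := mul_le_mul_of_nonneg_left (hd z₁ hz₁ z₂ hz₂ t ht₀ ht₁) hμ
  simp only [smul_eq_mul] at hconvex
  linarith

lemma bddBelow_image_add_const_mul (hQ : IsCompact Q) (hg : ContinuousOn g Q)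
    (hd : ∀ z ∈ Q, 0 ≤ d z) (hμ : 0 ≤ μ) : BddBelow ((fun z => g z + μ * d z) '' Q) := by
  obtain ⟨b, hb⟩ := (hQ.image_of_continuousOn hg).bddBelow
  refine ⟨b, ?_⟩
  rintro _ ⟨z, hz, rfl⟩
  exact (hb ⟨z, hz, rfl⟩).trans (le_add_of_nonneg_right (mul_nonneg hμ (hd z hz)))

variable {E : Type*} [NormedAddCommGroup E] [NormedSpace ℝ E] {L : (Fin m → ℝ) →ₗ[ℝ] E}

lemma exists_quadratic_bounds_smoothed (hne : Q.Nonempty) (hQ : IsCompact Q)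
    (hconv : Convex ℝ Q) (hg : ConvexOn ℝ Set.univ g) (hd : IsProxFunction p v Q σ d) (hσ : 0 < σ)
    (hμ : 0 < μ) (hL : IsDualNormMap p v L) (x : BlockSpace N) :
    ∃ y : BlockSpace N, ∀ h,
      smoothed A Q g d μ x + inner ℝ y h ≤ smoothed A Q g d μ (x + h) ∧
      smoothed A Q g d μ (x + h) ≤
        smoothed A Q g d μ x + inner ℝ y h + ‖L (A *ᵥ h.ofLp)‖ ^ 2 / (2 * (μ * σ)) := by
  have hbdd : BddBelow ((fun z => g z + μ * d z) '' Q) :=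
    bddBelow_image_add_const_mul hQ ((hg.continuousOn isOpen_univ).mono (Set.subset_univ Q))
      hd.2.1 hμ.le
  have hsc := hd.1.stronglyConvexWrt_add_const_mul (hg.subset (Set.subset_univ Q) hconv) hμ.le
  obtain ⟨z₀, hz₀⟩ := exists_isMaximizingLimit hne hQ hbdd (pairing A x)
  refine ⟨WithLp.toLp 2 (Aᵀ *ᵥ z₀), fun h => ?_⟩
  have hgrad : inner ℝ (WithLp.toLp 2 (Aᵀ *ᵥ z₀)) h = pairing A h z₀ := by
    rw [EuclideanSpace.inner_eq_star_dotProduct, star_trivial, mulVec_transpose,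
      dotProduct_comm, ← dotProduct_mulVec, dotProduct_comm, pairing_apply]
  simp only [smoothed_eq_conjugateOn, map_add, hgrad]
  refine ⟨hz₀.add_le_conjugateOn hQ hbdd _,
    hz₀.conjugateOn_add_le hne hQ hconv hbdd (mul_pos hμ hσ) hsc fun z => ?_⟩
  rw [pairing_apply, dotProduct_comm]
  exact hL.dotProduct_le z _

lemma exists_hasGradientAt_smoothed (hne : Q.Nonempty) (hQ : IsCompact Q) (hconv : Convex ℝ Q)
    (hg : ConvexOn ℝ Set.univ g) (hd : IsProxFunction p v Q σ d) (hσ : 0 < σ) (hμ : 0 < μ)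
    (hL : IsDualNormMap p v L) (x : BlockSpace N) :
    ∃ y, HasGradientAt (smoothed A Q g d μ) y x ∧ ∀ h, smoothed A Q g d μ (x + h) ≤
      smoothed A Q g d μ x + inner ℝ y h + ‖L (A *ᵥ h.ofLp)‖ ^ 2 / (2 * (μ * σ)) := by
  obtain ⟨y, hy⟩ :=
    exists_quadratic_bounds_smoothed (A := A) hne hQ hconv hg hd hσ hμ hL x
  let T : BlockSpace N →L[ℝ] E := LinearMap.toContinuousLinearMap
    (L ∘ₗ A.mulVecLin ∘ₗ (WithLp.linearEquiv 2 ℝ _).toLinearMap)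
  refine ⟨y, hasGradientAt_of_quadratic_bounds (C := ‖T‖ ^ 2 / (2 * (μ * σ)))
    (fun h => (hy h).1) fun h => (hy h).2.trans ?_, fun h => (hy h).2⟩
  have hT : ‖L (A *ᵥ h.ofLp)‖ ≤ ‖T‖ * ‖h‖ := T.le_opNorm h
  calc _ ≤ smoothed A Q g d μ x + inner ℝ y h + (‖T‖ * ‖h‖) ^ 2 / (2 * (μ * σ)) := by gcongr
    _ = _ := by ring

end Smoothing

section Sampling

variable {n : ℕ} {Om : Type*} [MeasurableSpace Om] {P : Measure Om} {τ : ℕ}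
  {S : Om → Finset (Fin n)}

lemma IsSampling.integral_eq_sum [IsFiniteMeasure P] (hS : IsSampling S)
    (φ : Finset (Fin n) → ℝ) : ∫ s, φ (S s) ∂P = ∑ T, P.real {s | S s = T} * φ T := by
  let _ : MeasurableSpace (Finset (Fin n)) := ⊤
  have hSm : Measurable S := measurable_to_countable' hS
  rw [← integral_map hSm.aemeasurable measurable_from_top.aestronglyMeasurable,
    integral_fintype Integrable.of_finite]
  refine Finset.sum_congr rfl fun T _ => ?_
  rw [map_measureReal_apply hSm (measurableSet_singleton T), smul_eq_mul]
  rfl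

namespace IsTauNice

lemma le (hS : IsTauNice P τ S) : τ ≤ n := by
  obtain ⟨s, hs⟩ : {s | (S s).card = τ}.Nonempty :=
    nonempty_of_measure_ne_zero (μ := P) (by rw [hS.1.2]; exact one_ne_zero)
  exact hs ▸ card_finset_fin_le (S s)

variable [IsProbabilityMeasure P]

lemma real_eq_zero (hS : IsTauNice P τ S) {T : Finset (Fin n)} (hT : T.card ≠ τ) :
    P.real {s | S s = T} = 0 := by
  have hmeas : MeasurableSet {s | (S s).card = τ} := by
    let _ : MeasurableSpace (Finset (Fin n)) := ⊤
    exact measurable_to_countable' hS.1.1.1 (t := {T | T.card = τ}) trivial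
  have hnull : P {s | (S s).card = τ}ᶜ = 0 := (prob_compl_eq_zero_iff hmeas).2 hS.1.2
  refine (measureReal_eq_zero_iff).2 (measure_mono_null ?_ hnull)
  rintro s rfl
  exact hT

lemma integral_eq_mul_sum (hS : IsTauNice P τ S) {T₀ : Finset (Fin n)} (hT₀ : T₀.card = τ)
    (φ : Finset (Fin n) → ℝ) :
    ∫ s, φ (S s) ∂P = P.real {s | S s = T₀} * ∑ T ∈ Finset.univ.powersetCard τ, φ T := by
  rw [hS.1.1.1.integral_eq_sum, Finset.mul_sum,
    ← Finset.sum_subset (Finset.subset_univ (Finset.univ.powersetCard τ))]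
  · refine Finset.sum_congr rfl fun T hT => ?_
    rw [measureReal_def, hS.2 T T₀ (Finset.mem_powersetCard.1 hT).2 hT₀, measureReal_def]
  · intro T _ hT
    rw [hS.real_eq_zero (by simpa using hT), zero_mul]

lemma integral_eq_expect (hS : IsTauNice P τ S) (φ : Finset (Fin n) → ℝ) :
    ∫ s, φ (S s) ∂P = 𝔼 T ∈ Finset.univ.powersetCard τ, φ T := by
  obtain ⟨T₀, -, hT₀⟩ := Finset.exists_subset_card_eq (s := (Finset.univ : Finset (Fin n)))
    (by simpa using hS.le)
  have htotal : P.real {s | S s = T₀} * (Finset.univ.powersetCard τ : Finset (Finset (Fin n))).card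
      = 1 := by
    simpa using (hS.integral_eq_mul_sum hT₀ fun _ => 1).symm
  rw [hS.integral_eq_mul_sum hT₀, Finset.expect_eq_sum_div_card, eq_div_iff
    (right_ne_zero_of_mul_eq_one htotal), mul_right_comm, htotal, one_mul]

lemma integral_card (hS : IsTauNice P τ S) : ∫ s, ((S s).card : ℝ) ∂P = τ := by
  rw [hS.integral_eq_expect fun T => (T.card : ℝ), Finset.expect_congr rfl fun T hT => by
    rw [(Finset.mem_powersetCard.1 hT).2]]
  exact Finset.expect_const (Finset.powersetCard_nonempty.2 (by simpa using hS.le)) _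

end IsTauNice

end Sampling

section Moments

variable {ι : Type*} {Ω : Finset ι} {τ : ℕ}

lemma expect_powersetCard_subset [DecidableEq ι] {s : Finset ι} (hs : s ⊆ Ω) (hτ : τ ≤ Ω.card) :
    𝔼 T ∈ Ω.powersetCard τ, (if s ⊆ T then (1 : ℝ) else 0) =
      τ.descFactorial s.card / Ω.card.descFactorial s.card := by
  have hchoose : (0 : ℝ) < Ω.card.choose τ := by exact_mod_cast Nat.choose_pos hτ
  have hdesc : (0 : ℝ) < Ω.card.descFactorial s.card := by
    exact_mod_cast Nat.descFactorial_pos.2 (Finset.card_le_card hs)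
  rw [Finset.expect_eq_sum_div_card, Finset.card_powersetCard, Finset.sum_boole,
    div_eq_div_iff hchoose.ne' hdesc.ne']
  norm_cast
  rcases le_or_gt s.card τ with hsτ | hsτ
  · rw [Finset.card_filter_powersetCard_subset _ _ _ hs hsτ,
      Nat.descFactorial_eq_factorial_mul_choose, Nat.descFactorial_eq_factorial_mul_choose,
      mul_left_comm, mul_assoc, mul_comm (τ.choose _), Nat.choose_mul hsτ,
      mul_comm (Nat.choose _ _)]
  · rw [Nat.descFactorial_eq_zero_iff_lt.2 hsτ, zero_mul, Finset.card_eq_zero.2, zero_mul]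
    refine Finset.filter_eq_empty_iff.2 fun T hT hsT => ?_
    exact hsτ.not_ge ((Finset.card_le_card hsT).trans_eq (Finset.mem_powersetCard.1 hT).2)

lemma expect_powersetCard_sum (hτ : τ ≤ Ω.card) (q : ι → ℝ) :
    𝔼 T ∈ Ω.powersetCard τ, ∑ i ∈ T, q i = τ / Ω.card * ∑ i ∈ Ω, q i := by
  classical
  have hindicator : ∀ T ∈ Ω.powersetCard τ,
      ∑ i ∈ T, q i = ∑ i ∈ Ω, (if {i} ⊆ T then 1 else 0) * q i := fun T hT => by
    simp [Finset.sum_ite_mem, Finset.inter_eq_right.2 (Finset.mem_powersetCard.1 hT).1]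
  rw [Finset.expect_congr rfl hindicator, Finset.expect_sum_comm, Finset.mul_sum]
  refine Finset.sum_congr rfl fun i hi => ?_
  rw [← Finset.expect_mul, expect_powersetCard_subset (Finset.singleton_subset_iff.2 hi) hτ]
  simp

lemma expect_powersetCard_pair [DecidableEq ι] (hτ : τ ≤ Ω.card) {i j : ι} (hi : i ∈ Ω)
    (hj : j ∈ Ω) :
    𝔼 T ∈ Ω.powersetCard τ, (if {i, j} ⊆ T then (1 : ℝ) else 0) =
      τ / Ω.card * (if i = j then 1 else ((τ : ℝ) - 1) / max 1 ((Ω.card : ℝ) - 1)) := by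
  have hsub : {i, j} ⊆ Ω := Finset.insert_subset hi (Finset.singleton_subset_iff.2 hj)
  rw [expect_powersetCard_subset hsub hτ]
  split_ifs with hij
  · simp [hij]
  · have htwo : (2 : ℝ) ≤ Ω.card := by
      exact_mod_cast Finset.card_pair hij ▸ Finset.card_le_card hsub
    rw [Finset.card_pair hij, Nat.cast_descFactorial_two, Nat.cast_descFactorial_two,
      max_eq_right (by linarith), mul_div_mul_comm]

lemma expect_powersetCard_sq_sum (hτ : τ ≤ Ω.card) (a : ι → ℝ) :
    𝔼 T ∈ Ω.powersetCard τ, (∑ i ∈ T, a i) ^ 2 =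
      τ / Ω.card * (∑ i ∈ Ω, a i ^ 2 + ((τ : ℝ) - 1) / max 1 ((Ω.card : ℝ) - 1) *
        ((∑ i ∈ Ω, a i) ^ 2 - ∑ i ∈ Ω, a i ^ 2)) := by
  classical
  set θ := ((τ : ℝ) - 1) / max 1 ((Ω.card : ℝ) - 1)
  have hindicator : ∀ T ∈ Ω.powersetCard τ, (∑ i ∈ T, a i) ^ 2 =
      ∑ i ∈ Ω, ∑ j ∈ Ω, (if {i, j} ⊆ T then 1 else 0) * (a i * a j) := fun T hT => by
    have hTΩ := Finset.inter_eq_right.2 (Finset.mem_powersetCard.1 hT).1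
    simp [Finset.insert_subset_iff, ite_and, Finset.sum_ite_mem, hTΩ, sq, Finset.sum_mul_sum]
  have hpair : ∀ i ∈ Ω, ∀ j ∈ Ω,
      𝔼 T ∈ Ω.powersetCard τ, (if {i, j} ⊆ T then 1 else 0) * (a i * a j) =
        τ / Ω.card * (θ * (a i * a j) + if i = j then (1 - θ) * (a i * a j) else 0) := by
    intro i hi j hj
    rw [← Finset.expect_mul, expect_powersetCard_pair hτ hi hj]
    split_ifs <;> ring
  simp_rw [Finset.expect_congr rfl hindicator, Finset.expect_sum_comm]
  rw [Finset.sum_congr rfl fun i hi => Finset.sum_congr rfl (hpair i hi)]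
  simp only [← Finset.mul_sum, Finset.sum_add_distrib, Finset.sum_ite_eq,
    Finset.sum_ite_mem, Finset.inter_self, ← Finset.sum_mul, ← sq]
  ring

end Moments

section EuclideanMoment

variable {ι : Type*} {τ ω : ℕ}

lemma betaTwo_pos {n : ℕ} (hω : 1 ≤ ω) (hτ : 1 ≤ τ) : 0 < betaTwo n ω τ := by
  have hω' : (0 : ℝ) ≤ ω - 1 := sub_nonneg.2 (by exact_mod_cast hω)
  have hτ' : (0 : ℝ) ≤ τ - 1 := sub_nonneg.2 (by exact_mod_cast hτ)
  unfold betaTwo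
  positivity

variable [Fintype ι]

lemma sq_sum_le_ncard_support_mul (a : ι → ℝ) :
    (∑ i, a i) ^ 2 ≤ (Function.support a).ncard * ∑ i, a i ^ 2 := by
  classical
  have hsum : ∑ i, a i = ∑ i ∈ (Function.support a).toFinset, a i :=
    (Finset.sum_subset (Finset.subset_univ _) fun i _ hi => by simpa using hi).symm
  rw [hsum, Set.ncard_eq_toFinset_card']
  refine sq_sum_le_card_mul_sum_sq.trans ?_
  gcongr
  exact Finset.subset_univ _

lemma expect_sq_sum_le_betaTwo (hτ₁ : 1 ≤ τ) (hτ : τ ≤ Fintype.card ι) {a : ι → ℝ}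
    (ha : (Function.support a).ncard ≤ ω) :
    𝔼 T ∈ Finset.univ.powersetCard τ, (∑ i ∈ T, a i) ^ 2 ≤
      τ / Fintype.card ι * (betaTwo (Fintype.card ι) ω τ * ∑ i, a i ^ 2) := by
  have hτ' : (0 : ℝ) ≤ τ - 1 := sub_nonneg.2 (by exact_mod_cast hτ₁)
  have hsupport : (∑ i, a i) ^ 2 ≤ ω * ∑ i, a i ^ 2 :=
    (sq_sum_le_ncard_support_mul a).trans (by gcongr)
  rw [expect_powersetCard_sq_sum hτ, Finset.card_univ]
  calc _ ≤ (τ : ℝ) / Fintype.card ι * (∑ i, a i ^ 2 +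
          (τ - 1) / max 1 ((Fintype.card ι : ℝ) - 1) * (ω * ∑ i, a i ^ 2 - ∑ i, a i ^ 2)) := by
        gcongr
    _ = _ := by
        rw [betaTwo]
        ring

lemma expect_norm_sum_sq_le_betaTwo {κ : Type*} [Fintype κ] (hτ₁ : 1 ≤ τ)
    (hτ : τ ≤ Fintype.card ι) {u : ι → EuclideanSpace ℝ κ}
    (hu : ∀ j, (Function.support fun i => u i j).ncard ≤ ω) :
    𝔼 T ∈ Finset.univ.powersetCard τ, ‖∑ i ∈ T, u i‖ ^ 2 ≤
      τ / Fintype.card ι * (betaTwo (Fintype.card ι) ω τ * ∑ i, ‖u i‖ ^ 2) := by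
  simp only [EuclideanSpace.real_norm_sq_eq, WithLp.ofLp_sum, Finset.sum_apply]
  rw [Finset.expect_sum_comm, Finset.sum_comm (s := Finset.univ (α := ι)), Finset.mul_sum,
    Finset.mul_sum]
  exact Finset.sum_le_sum fun j _ => expect_sq_sum_le_betaTwo hτ₁ hτ (hu j)

end EuclideanMoment

section SupMoment

variable {ι : Type*} {τ ω k l : ℕ}

lemma div_le_cCoef (n ω τ l : ℕ) : (l : ℝ) / ω ≤ cCoef n ω τ l := by
  unfold cCoef
  split_ifs
  · exact le_max_left _ _
  · exact le_rfl

lemma cCoef_nonneg (n ω τ l : ℕ) : 0 ≤ cCoef n ω τ l :=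
  (by positivity : (0 : ℝ) ≤ l / ω).trans (div_le_cCoef n ω τ l)

lemma piProb_nonneg (n ω τ l : ℕ) : 0 ≤ piProb n ω τ l := by
  unfold piProb
  positivity

lemma piProb_pos {n : ℕ} (hlω : l ≤ ω) (hl : τ - l ≤ n - ω) (hτ : τ ≤ n) :
    0 < piProb n ω τ l := by
  have hω_choose := Nat.choose_pos hlω
  have hcompl_choose := Nat.choose_pos hl
  have hτ_choose := Nat.choose_pos hτ
  unfold piProb
  positivity

/-- The inner sum of `betaThree`: a bound, relative to the total mass, for the expected mass that a
random set of size `τ` collects on a set of size `ω` it meets in at least `k` points. -/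
noncomputable def tailCoef (n ω τ k : ℕ) : ℝ :=
  ∑ l ∈ Finset.Icc (max k (kMin n ω τ)) (kMax ω τ), cCoef n ω τ l * piProb n ω τ l

lemma tailCoef_nonneg (n ω τ k : ℕ) : 0 ≤ tailCoef n ω τ k :=
  Finset.sum_nonneg fun l _ => mul_nonneg (cCoef_nonneg n ω τ l) (piProb_nonneg n ω τ l)

lemma tailCoef_one_pos {n : ℕ} (hω : 1 ≤ ω) (hωn : ω ≤ n) (hτ : 1 ≤ τ) (hτn : τ ≤ n) :
    0 < tailCoef n ω τ 1 := by
  have hkMax : 1 ≤ kMax ω τ := le_min hτ hω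
  refine Finset.sum_pos' (fun l _ => mul_nonneg (cCoef_nonneg n ω τ l) (piProb_nonneg n ω τ l))
    ⟨kMax ω τ, ?_, mul_pos (lt_of_lt_of_le ?_ (div_le_cCoef n ω τ _)) (piProb_pos ?_ ?_ hτn)⟩
  · simp only [Finset.mem_Icc, kMin, kMax]
    omega
  · positivity
  · exact min_le_right _ _
  · unfold kMax
    omega

lemma betaThree_pos {m n : ℕ} (hm : 1 ≤ m) (hω : 1 ≤ ω) (hωn : ω ≤ n) (hτ : 1 ≤ τ)
    (hτn : τ ≤ n) : 0 < betaThree m n ω τ := by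
  have hn : 1 ≤ n := hω.trans hωn
  refine Finset.sum_pos' (fun k _ => le_min zero_le_one
    (mul_nonneg (by positivity) (tailCoef_nonneg n ω τ k))) ⟨1, ?_, ?_⟩
  · exact Finset.mem_Icc.2 ⟨le_rfl, le_min hτ hω⟩
  · exact lt_min one_pos (mul_pos (by positivity) (tailCoef_one_pos hω hωn hτ hτn))

section Layers

variable [DecidableEq ι]

/-- The mass that `q` gives to `T ∩ R`, counted only if `T` meets `R` in at least `k` points.
Summing over `k` produces the factor `#(T ∩ R)` of the Cauchy-Schwarz inequality on `T ∩ R`. -/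
noncomputable def massAbove (R : Finset ι) (q : ι → ℝ) (k : ℕ) (T : Finset ι) : ℝ :=
  if k ≤ (T ∩ R).card then ∑ i ∈ T ∩ R, q i else 0

lemma massAbove_nonneg {q : ι → ℝ} (hq : 0 ≤ q) (R : Finset ι) (k : ℕ) (T : Finset ι) :
    0 ≤ massAbove R q k T := by
  unfold massAbove
  split_ifs
  · exact Finset.sum_nonneg fun i _ => hq i
  · exact le_rfl

lemma massAbove_le_sum {q : ι → ℝ} (hq : 0 ≤ q) (R : Finset ι) (k : ℕ) (T : Finset ι) :
    massAbove R q k T ≤ ∑ i ∈ T, q i := by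
  unfold massAbove
  split_ifs
  · exact Finset.sum_le_sum_of_subset_of_nonneg Finset.inter_subset_left fun i _ _ => hq i
  · exact Finset.sum_nonneg fun i _ => hq i

lemma sum_massAbove {K : ℕ} {R T : Finset ι} (hK : (T ∩ R).card ≤ K) (q : ι → ℝ) :
    ∑ k ∈ Finset.Icc 1 K, massAbove R q k T = (T ∩ R).card * ∑ i ∈ T ∩ R, q i := by
  have hlayers : (Finset.Icc 1 K).filter (· ≤ (T ∩ R).card) = Finset.Icc 1 (T ∩ R).card := by
    ext k
    simp only [Finset.mem_filter, Finset.mem_Icc]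
    omega
  simp only [massAbove]
  rw [← Finset.sum_filter, hlayers, Finset.sum_const, Nat.card_Icc, Nat.add_sub_cancel,
    nsmul_eq_mul]

lemma card_inter_le_kMax {R T : Finset ι} (hR : R.card = ω) (hT : T.card = τ) :
    (T ∩ R).card ≤ kMax ω τ :=
  le_min (hT ▸ Finset.card_le_card Finset.inter_subset_left)
    (hR ▸ Finset.card_le_card Finset.inter_subset_right)

lemma sq_sum_le_sum_massAbove {a q : ι → ℝ} {R T : Finset ι} (hR : R.card = ω) (hT : T.card = τ)
    (ha : ∀ i ∉ R, a i = 0) (haq : ∀ i, a i ^ 2 ≤ q i) :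
    (∑ i ∈ T, a i) ^ 2 ≤ ∑ k ∈ Finset.Icc 1 (kMax ω τ), massAbove R q k T := by
  rw [sum_massAbove (card_inter_le_kMax hR hT), ← Finset.sum_subset Finset.inter_subset_left
    fun i hiT hi => ha i fun hiR => hi (Finset.mem_inter.2 ⟨hiT, hiR⟩)]
  refine sq_sum_le_card_mul_sum_sq.trans ?_
  gcongr with i
  exact haq i

variable [Fintype ι]

lemma kMin_le_card_inter {R T : Finset ι} (hR : R.card = ω) (hT : T.card = τ)
    (hne : 1 ≤ (T ∩ R).card) : kMin (Fintype.card ι) ω τ ≤ (T ∩ R).card := by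
  have hcompl : (T \ R).card ≤ Fintype.card ι - ω := by
    rw [← hR, ← Finset.card_compl]
    exact Finset.card_le_card fun i hi => Finset.mem_compl.2 (Finset.mem_sdiff.1 hi).2
  have hsplit := Finset.card_sdiff_add_card_inter T R
  simp only [kMin]
  omega

lemma sum_ite_card_inter (R : Finset ι) (hl : l ≤ τ) (ψ : Finset ι → ℝ) :
    ∑ T ∈ Finset.univ.powersetCard τ, (if (T ∩ R).card = l then ψ (T ∩ R) else 0) =
      (Fintype.card ι - R.card).choose (τ - l) * ∑ U ∈ R.powersetCard l, ψ U := by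
  have hinter {U V : Finset ι} (hU : U ⊆ R) (hV : V ⊆ Rᶜ) : (U ∪ V) ∩ R = U := by
    rw [Finset.union_inter_distrib_right, Finset.inter_eq_left.2 hU,
      Finset.disjoint_iff_inter_eq_empty.1 (Finset.subset_compl_iff_disjoint_right.1 hV),
      Finset.union_empty]
  have hsdiff {U V : Finset ι} (hU : U ⊆ R) (hV : V ⊆ Rᶜ) : (U ∪ V) \ R = V := by
    rw [Finset.union_sdiff_distrib, Finset.sdiff_eq_empty_iff_subset.2 hU, Finset.empty_union,
      Finset.sdiff_eq_self_of_disjoint (Finset.subset_compl_iff_disjoint_right.1 hV)]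
  have hsplit : ∑ T ∈ (Finset.univ.powersetCard τ).filter (fun T => (T ∩ R).card = l), ψ (T ∩ R) =
      ∑ UV ∈ R.powersetCard l ×ˢ Rᶜ.powersetCard (τ - l), ψ UV.1 := by
    refine Finset.sum_nbij' (fun T => (T ∩ R, T \ R)) (fun UV => UV.1 ∪ UV.2) ?_ ?_
      (fun T _ => sup_inf_sdiff T R) ?_ fun _ _ => rfl
    · intro T hT
      have hcard := Finset.card_sdiff_add_card_inter T R
      simp only [Finset.mem_filter, Finset.mem_powersetCard, Finset.mem_product] at hT ⊢
      refine ⟨⟨Finset.inter_subset_right, hT.2⟩, fun i hi => ?_, by omega⟩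
      exact Finset.mem_compl.2 (Finset.mem_sdiff.1 hi).2
    · rintro ⟨U, V⟩ hUV
      simp only [Finset.mem_filter, Finset.mem_powersetCard, Finset.mem_product] at hUV ⊢
      obtain ⟨⟨hU, hUl⟩, hV, hVl⟩ := hUV
      have hdisj : Disjoint U V := (Finset.subset_compl_iff_disjoint_left.1 hV).mono_left hU
      rw [hinter hU hV, Finset.card_union_of_disjoint hdisj]
      exact ⟨⟨Finset.subset_univ _, by omega⟩, hUl⟩
    · rintro ⟨U, V⟩ hUV
      simp only [Finset.mem_powersetCard, Finset.mem_product] at hUV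
      rw [hinter hUV.1.1 hUV.2.1, hsdiff hUV.1.1 hUV.2.1]
  rw [← Finset.sum_filter, hsplit, Finset.sum_product]
  simp only [Finset.sum_const, Finset.card_powersetCard, Finset.card_compl, nsmul_eq_mul,
    Finset.mul_sum]

lemma expect_ite_card_inter (R : Finset ι) (hl : l ≤ τ) (ψ : Finset ι → ℝ) :
    𝔼 T ∈ Finset.univ.powersetCard τ, (if (T ∩ R).card = l then ψ (T ∩ R) else 0) =
      piProb (Fintype.card ι) R.card τ l * 𝔼 U ∈ R.powersetCard l, ψ U := by
  rw [Finset.expect_eq_sum_div_card, sum_ite_card_inter R hl, ← Finset.card_mul_expect,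
    Finset.card_powersetCard, Finset.card_powersetCard, Finset.card_univ, piProb]
  ring

lemma massAbove_eq_sum_ite {R T : Finset ι} (hR : R.card = ω) (hT : T.card = τ) (hk : 1 ≤ k)
    (q : ι → ℝ) :
    massAbove R q k T = ∑ l ∈ Finset.Icc (max k (kMin (Fintype.card ι) ω τ)) (kMax ω τ),
      if (T ∩ R).card = l then ∑ i ∈ T ∩ R, q i else 0 := by
  have hmem : (T ∩ R).card ∈ Finset.Icc (max k (kMin (Fintype.card ι) ω τ)) (kMax ω τ) ↔
      k ≤ (T ∩ R).card := by
    simp only [Finset.mem_Icc, max_le_iff]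
    exact ⟨fun h => h.1.1, fun h =>
      ⟨⟨h, kMin_le_card_inter hR hT (hk.trans h)⟩, card_inter_le_kMax hR hT⟩⟩
  rw [Finset.sum_ite_eq, massAbove]
  exact if_congr hmem.symm rfl rfl

lemma expect_massAbove_le {R : Finset ι} (hR : R.card = ω) (hk : 1 ≤ k) {q : ι → ℝ}
    (hq : 0 ≤ q) :
    𝔼 T ∈ Finset.univ.powersetCard τ, massAbove R q k T ≤
      tailCoef (Fintype.card ι) ω τ k * ∑ i, q i := by
  rw [Finset.expect_congr rfl fun T hT =>
    massAbove_eq_sum_ite hR (Finset.mem_powersetCard.1 hT).2 hk q, Finset.expect_sum_comm,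
    tailCoef, Finset.sum_mul]
  refine Finset.sum_le_sum fun l hl => ?_
  obtain ⟨hlτ, hlω⟩ := le_min_iff.1 (Finset.mem_Icc.1 hl).2
  rw [expect_ite_card_inter R hlτ fun U => ∑ i ∈ U, q i, hR,
    expect_powersetCard_sum (hlω.trans_eq hR.symm), hR, mul_comm (cCoef _ _ _ _), mul_assoc]
  gcongr
  · exact piProb_nonneg _ _ _ _
  · exact Finset.sum_nonneg fun i _ => hq i
  · exact cCoef_nonneg _ _ _ _
  · exact div_le_cCoef _ _ _ _
  · exact fun i _ _ => hq i
  · exact Finset.subset_univ R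

lemma expect_massAbove_selected_le {κ : Type*} [Fintype κ] (hτ₁ : 1 ≤ τ)
    (hτ : τ ≤ Fintype.card ι) {R : κ → Finset ι} (hR : ∀ j, (R j).card = ω)
    (J : Finset ι → κ) (hk : 1 ≤ k) {q : ι → ℝ} (hq : 0 ≤ q) :
    𝔼 T ∈ Finset.univ.powersetCard τ, massAbove (R (J T)) q k T ≤
      τ / Fintype.card ι * (min 1 ((Fintype.card κ : ℝ) * Fintype.card ι / τ *
        tailCoef (Fintype.card ι) ω τ k) * ∑ i, q i) := by
  have hn : 1 ≤ Fintype.card ι := hτ₁.trans hτ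
  have htrivial : 𝔼 T ∈ Finset.univ.powersetCard τ, massAbove (R (J T)) q k T ≤
      τ / Fintype.card ι * ∑ i, q i := by
    rw [← Finset.card_univ, ← expect_powersetCard_sum hτ]
    exact Finset.expect_le_expect fun T _ => massAbove_le_sum hq (R (J T)) k T
  have hunion : 𝔼 T ∈ Finset.univ.powersetCard τ, massAbove (R (J T)) q k T ≤
      Fintype.card κ * (tailCoef (Fintype.card ι) ω τ k * ∑ i, q i) := by
    calc 𝔼 T ∈ Finset.univ.powersetCard τ, massAbove (R (J T)) q k T
        ≤ 𝔼 T ∈ Finset.univ.powersetCard τ, ∑ j, massAbove (R j) q k T :=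
          Finset.expect_le_expect fun T _ => Finset.single_le_sum
            (f := fun j => massAbove (R j) q k T)
            (fun j _ => massAbove_nonneg hq (R j) k T) (Finset.mem_univ (J T))
      _ = ∑ j, 𝔼 T ∈ Finset.univ.powersetCard τ, massAbove (R j) q k T :=
          Finset.expect_sum_comm _ _ _
      _ ≤ Fintype.card κ • (tailCoef (Fintype.card ι) ω τ k * ∑ i, q i) :=
          Finset.sum_le_card_nsmul _ _ _ fun j _ => expect_massAbove_le (hR j) hk hq
      _ = _ := nsmul_eq_mul _ _
  rcases min_choice (1 : ℝ) ((Fintype.card κ : ℝ) * Fintype.card ι / τ *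
    tailCoef (Fintype.card ι) ω τ k) with hmin | hmin <;> rw [hmin]
  · simpa using htrivial
  · refine hunion.trans_eq ?_
    field_simp

end Layers

lemma expect_norm_sum_sq_le_betaThree [Fintype ι] {κ : Type*} [Fintype κ] [Nonempty κ]
    (hω : ω ≤ Fintype.card ι) (hτ₁ : 1 ≤ τ) (hτ : τ ≤ Fintype.card ι)
    {u : ι → PiLp ∞ fun _ : κ => ℝ}
    (hu : ∀ j, (Function.support fun i => u i j).ncard ≤ ω) :
    𝔼 T ∈ Finset.univ.powersetCard τ, ‖∑ i ∈ T, u i‖ ^ 2 ≤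
      τ / Fintype.card ι *
        (betaThree (Fintype.card κ) (Fintype.card ι) ω τ * ∑ i, ‖u i‖ ^ 2) := by
  classical
  have hextend (j : κ) : ∃ R : Finset ι, (∀ i ∉ R, u i j = 0) ∧ R.card = ω := by
    obtain ⟨R, hsub, hcard⟩ := Finset.exists_superset_card_eq
      ((Set.ncard_eq_toFinset_card' _).symm.trans_le (hu j)) hω
    exact ⟨R, fun i hi => by simpa using fun h => hi (hsub h), hcard⟩
  choose R hzero hR using hextend
  choose J hJ using fun T : Finset ι => exists_norm_eq_norm_apply (∑ i ∈ T, u i)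
  have hlayers : ∀ T ∈ Finset.univ.powersetCard τ, ‖∑ i ∈ T, u i‖ ^ 2 ≤
      ∑ k ∈ Finset.Icc 1 (kMax ω τ), massAbove (R (J T)) (fun i => ‖u i‖ ^ 2) k T := by
    intro T hT
    rw [hJ T, WithLp.ofLp_sum, Finset.sum_apply, Real.norm_eq_abs, sq_abs]
    refine sq_sum_le_sum_massAbove (hR _) (Finset.mem_powersetCard.1 hT).2 (hzero _) fun i => ?_
    rw [← sq_abs, ← Real.norm_eq_abs]
    gcongr
    exact PiLp.norm_apply_le (u i) (J T)
  refine (Finset.expect_le_expect hlayers).trans ?_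
  rw [Finset.expect_sum_comm, betaThree, Finset.sum_mul, Finset.mul_sum]
  exact Finset.sum_le_sum fun k hk => expect_massAbove_selected_le hτ₁ hτ hR J
    (Finset.mem_Icc.1 hk).1 fun i => sq_nonneg _

end SupMoment

section ESO

variable {m n : ℕ} {N : Fin n → ℕ} {A : Matrix (Fin m) (Σ i : Fin n, Fin (N i)) ℝ} {τ ω : ℕ}
  {E : Type*} [NormedAddCommGroup E] [NormedSpace ℝ E] {L : (Fin m → ℝ) →ₗ[ℝ] E} {β : ℝ}

lemma expect_add_restrictBlocks_le {φ : BlockSpace N → ℝ} {x y : BlockSpace N} {c : ℝ}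
    (hc : 0 < c) (hτ : τ ≤ n)
    (hφ : ∀ h, φ (x + h) ≤ φ x + inner ℝ y h + ‖L (A *ᵥ h.ofLp)‖ ^ 2 / (2 * c))
    {h : BlockSpace N} (hmoment : 𝔼 T ∈ Finset.univ.powersetCard τ,
      ‖∑ i ∈ T, L (colBlock A i *ᵥ block h i)‖ ^ 2 ≤
        τ / n * (β * ∑ i, ‖L (colBlock A i *ᵥ block h i)‖ ^ 2)) :
    𝔼 T ∈ Finset.univ.powersetCard τ, φ (x + restrictBlocks h T) ≤
      φ x + τ / n * (inner ℝ y h + β / c / 2 * ∑ i, ‖L (colBlock A i *ᵥ block h i)‖ ^ 2) := by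
  have hτ' : τ ≤ (Finset.univ : Finset (Fin n)).card := by simpa using hτ
  have hlinear : 𝔼 T ∈ Finset.univ.powersetCard τ, ∑ i ∈ T, block y i ⬝ᵥ block h i =
      τ / n * inner ℝ y h := by
    rw [expect_powersetCard_sum hτ', inner_eq_sum_block, Finset.card_univ, Fintype.card_fin]
  calc 𝔼 T ∈ Finset.univ.powersetCard τ, φ (x + restrictBlocks h T)
      ≤ 𝔼 T ∈ Finset.univ.powersetCard τ, (φ x + ∑ i ∈ T, block y i ⬝ᵥ block h i +
          ‖∑ i ∈ T, L (colBlock A i *ᵥ block h i)‖ ^ 2 / (2 * c)) := by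
        refine Finset.expect_le_expect fun T _ => ?_
        rw [← inner_restrictBlocks, ← map_sum, ← mulVec_restrictBlocks]
        exact hφ _
    _ = φ x + τ / n * inner ℝ y h + (𝔼 T ∈ Finset.univ.powersetCard τ,
          ‖∑ i ∈ T, L (colBlock A i *ᵥ block h i)‖ ^ 2) / (2 * c) := by
        rw [Finset.expect_add_distrib, Finset.expect_add_distrib, hlinear, Finset.expect_div,
          Finset.expect_const (Finset.powersetCard_nonempty.2 hτ')]
    _ ≤ φ x + τ / n * inner ℝ y h +
          (τ / n * (β * ∑ i, ‖L (colBlock A i *ᵥ block h i)‖ ^ 2)) / (2 * c) := by gcongr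
    _ = _ := by ring

variable {B : (i : Fin n) → Matrix (Fin (N i)) (Fin (N i)) ℝ} {Q : Set (Fin m → ℝ)}
  {g d : (Fin m → ℝ) → ℝ} {μ σ p : ℝ} {v : Fin m → ℝ}
  {Om : Type*} [MeasurableSpace Om] {P : Measure Om} [IsProbabilityMeasure P]
  {S : Om → Finset (Fin n)}

lemma IsDualNormMap.admitsESO_smoothed (hL : IsDualNormMap p v L) (hA : ∀ i, colBlock A i ≠ 0)
    (hB : ∀ i, (B i).PosDef) (hne : Q.Nonempty) (hQ : IsCompact Q) (hconv : Convex ℝ Q)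
    (hg : ConvexOn ℝ Set.univ g) (hd : IsProxFunction p v Q σ d) (hσ : 0 < σ)
    (hμ : 0 < μ) (hS : IsTauNice P τ S) (hβ : 0 < β)
    (hmoment : ∀ h : BlockSpace N, 𝔼 T ∈ Finset.univ.powersetCard τ,
      ‖∑ i ∈ T, L (colBlock A i *ᵥ block h i)‖ ^ 2 ≤
        τ / n * (β * ∑ i, ‖L (colBlock A i *ᵥ block h i)‖ ^ 2)) :
    AdmitsESO P S B (smoothed A Q g d μ) (β / (μ * σ)) (wStar p v A B) := by
  choose y hy using exists_hasGradientAt_smoothed (A := A) hne hQ hconv hg hd hσ hμ hL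
  refine ⟨fun x => (hy x).1.differentiableAt, by positivity, fun i => hL.wStar_pos (hA i) (hB i),
    fun x h => ?_⟩
  rw [(hy x).1.gradient, hS.integral_card,
    hS.integral_eq_expect fun T => smoothed A Q g d μ (x + restrictBlocks h T)]
  refine (expect_add_restrictBlocks_le (mul_pos hμ hσ) hS.le (hy x).2 (hmoment h)).trans ?_
  gcongr with i
  exact hL.norm_colBlock_mulVec_sq_le A (hB i) (block h i)

lemma ncard_support_divWeights_le (hω : ∀ j, (rowBlocks A j).ncard ≤ ω) (q : ℝ≥0∞)
    (v : Fin m → ℝ) (y : (i : Fin n) → Fin (N i) → ℝ) (j : Fin m) :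
    (Function.support fun i => divWeights q v (colBlock A i *ᵥ y i) j).ncard ≤ ω := by
  refine (Set.ncard_le_ncard fun i hi => ?_).trans (hω j)
  refine support_colBlock_mulVec_subset A j y fun hzero => hi ?_
  simp only [divWeights_apply, hzero, zero_div]

end ESO

end NesterovESO

theorem mainTheorem3 {m n : ℕ} {N : Fin n → ℕ}
    (A : Matrix (Fin m) (Σ i : Fin n, Fin (N i)) ℝ)
    (hA : ∀ i, NesterovESO.colBlock A i ≠ 0)
    (B : (i : Fin n) → Matrix (Fin (N i)) (Fin (N i)) ℝ)
    (hB : ∀ i, (B i).PosDef)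
    (Q : Set (Fin m → ℝ)) (g : (Fin m → ℝ) → ℝ) (ω : ℕ)
    (f : NesterovESO.BlockSpace N → ℝ)
    (hf : NesterovESO.IsNesterovSeparable A Q g ω f)
    (p : ℝ) (v : Fin m → ℝ) (hv : ∀ j, 0 < v j)
    (σ : ℝ) (hσ : 0 < σ) (d : (Fin m → ℝ) → ℝ)
    (hd : NesterovESO.IsProxFunction p v Q σ d)
    (μ : ℝ) (hμ : 0 < μ)
    {Om : Type*} [MeasurableSpace Om] (P : MeasureTheory.Measure Om)
    [MeasureTheory.IsProbabilityMeasure P]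
    (τ : ℕ) (hτ : 1 ≤ τ) (S : Om → Finset (Fin n))
    (hS : NesterovESO.IsTauNice P τ S) :
    (p = 2 →
      NesterovESO.AdmitsESO P S B (NesterovESO.smoothed A Q g d μ)
        (NesterovESO.betaTwo n ω τ / (μ * σ)) (NesterovESO.wStar p v A B)) ∧
    (p = 1 → ω ≤ n →
      NesterovESO.AdmitsESO P S B (NesterovESO.smoothed A Q g d μ)
        (NesterovESO.betaThree m n ω τ / (μ * σ)) (NesterovESO.wStar p v A B)) := by
  obtain ⟨hne, hQ, hconv, hg, -, hω⟩ := hf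
  have hτn : τ ≤ n := hS.le
  obtain ⟨j, hj⟩ := Function.ne_iff.1 (hA ⟨0, hτ.trans hτn⟩)
  have hω₁ : 1 ≤ ω := ((Set.ncard_pos (Set.toFinite _)).2 ⟨_, hj⟩).trans_le (hω j)
  constructor
  · rintro rfl
    refine (NesterovESO.isDualNormMap_two hv).admitsESO_smoothed hA hB hne hQ hconv hg hd hσ hμ hS
      (NesterovESO.betaTwo_pos hω₁ hτ) fun h => ?_
    simpa using NesterovESO.expect_norm_sum_sq_le_betaTwo hτ (by simpa using hτn)
      (NesterovESO.ncard_support_divWeights_le hω 2 v (NesterovESO.block h))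
  · rintro rfl hωn
    have : Nonempty (Fin m) := ⟨j⟩
    refine (NesterovESO.isDualNormMap_one hv).admitsESO_smoothed hA hB hne hQ hconv hg hd hσ hμ hS
      (NesterovESO.betaThree_pos j.pos hω₁ hωn hτ hτn) fun h => ?_
    simpa using NesterovESO.expect_norm_sum_sq_le_betaThree (by simpa using hωn) hτ
      (by simpa using hτn) (NesterovESO.ncard_support_divWeights_le hω _ v (NesterovESO.block h))
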